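/- Let $\mathcal{D}$ be a triangulated category with translation functor $[1]$, and let $(\mathcal{D}^{\leq 0},\mathcal{D}^{\geq 0})$ be a $t$-structure on $\mathcal{D}$ with heart $\mathcal{H}=\mathcal{D}^{\leq 0}\cap\mathcal{D}^{\geq 0}$, an abelian category. Assume that the $t$-structure is *hereditary*, that is, (i) it is bounded: for each $X\in\mathcal{D}$ there are integers $m\leq n$ with $X\in\mathcal{D}^{\leq n}\cap\mathcal{D}^{\geq m}$, where $\mathcal{D}^{\leq n}=\mathcal{D}^{\leq 0}[-n]$ and $\mathcal{D}^{\geq m}=\mathcal{D}^{\geq 0}[-m]$; and (ii) $\mathrm{Hom}_{\mathcal{D}}(X,Y[n])=0$ for all $X,Y\in\mathcal{H}$ and all $n\geq 2$. A *realization functor* of the $t$-structure is a triangle functor $F\colon \mathbf{D}^b(\mathcal{H})\to\mathcal{D}$ such that $F(\mathcal{H})=\mathcal{H}$ (up to isomorphism of objects) and such that the restriction $F|_{\mathcal{H}}$ is isomorphic to the identity functor of $\mathcal{H}$; here $\mathcal{H}$ is embedded in $\mathbf{D}^b(\mathcal{H})$ as the stalk complexes concentrated in degree $0$. Then any realization functor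 $F\colon \mathbf{D}^b(\mathcal{H})\to\mathcal{D}$ is a triangle equivalence; that is, $F$ is an equivalence of categories with a quasi-inverse that is also a triangle functor, the unit and the counit being compatible with the translations. -/

import Mathlib

open CategoryTheory CategoryTheory.Limits CategoryTheory.Pretriangulated CategoryTheory.Triangulated

universe w v u v' u'

section TriangleEquivalence

variable {C : Type u} {D : Type u'} [Category.{v} C] [Category.{v'} D]
  [Preadditive C] [Preadditive D] [HasZeroObject C] [HasZeroObject D]
  [HasShift C ℤ] [HasShift D ℤ]
  [∀ n : ℤ, (shiftFunctor C n).Additive] [∀ n : ℤ, (shiftFunctor D n).Additive]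
  [Pretriangulated C] [Pretriangulated D]

/-- A functor `F` (equipped with isomorphisms expressing that it commutes with the translations)
is a triangle equivalence if it is an equivalence of categories, and it has an adjoint
(hence a quasi-inverse) `G` which also commutes with the translations, such that both `F` and `G`
preserve exact triangles and the unit and the counit are compatible with the translations. -/
def CategoryTheory.Functor.IsTriangleEquivalence (F : C ⥤ D) [F.CommShift ℤ] : Prop :=
  F.IsEquivalence ∧
    ∃ (G : D ⥤ C) (_ : G.CommShift ℤ) (adj : F ⊣ G), adj.IsTriangulated

end TriangleEquivalence

namespace CategoryTheory.Triangulated.TStructure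

variable {D : Type u} [Category.{v} D] [Preadditive D] [HasZeroObject D] [HasShift D ℤ]
  [∀ n : ℤ, (shiftFunctor D n).Additive] [Pretriangulated D]

/-- A hereditary t-structure: a bounded t-structure such that `Hom(X, Y[n]) = 0` for
all `n ≥ 2` and all objects `X`, `Y` of the heart. -/
structure IsHereditary (t : TStructure D) : Prop where
  bounded (X : D) : t.bounded X
  hom_shift_eq_zero (X Y : D) (hX : t.heart X) (hY : t.heart Y) (n : ℤ) (hn : 2 ≤ n)
    (f : X ⟶ Y⟦n⟧) : f = 0

variable (t : TStructure D)

/-! The heart, as a full subcategory, is an abelian category. -/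

theorem heart_hom_negative_shift ⦃X Y : t.heart.FullSubcategory⦄ ⦃n : ℤ⦄
    (f : t.heart.ι.obj X ⟶ (t.heart.ι.obj Y)⟦n⟧) (hn : n < 0) : f = 0 := by
  have : t.IsLE (t.heart.ι.obj X) 0 := ((t.mem_heart_iff _).1 X.property).1
  have : t.IsGE (t.heart.ι.obj Y) 0 := ((t.mem_heart_iff _).1 Y.property).2
  have : t.IsGE ((t.heart.ι.obj Y)⟦n⟧) (-n) := t.isGE_shift _ 0 n (-n)
  exact t.zero f 0 (-n)

variable [IsTriangulated D]

theorem heart_admissibleMorphism :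
    AbelianSubcategory.admissibleMorphism t.heart.ι = ⊤ := by
  ext X₁ X₂ f
  simp only [MorphismProperty.top_apply, iff_true]
  intro X₃ f₂ f₃ hT
  have h₁ : t.IsLE X₁.obj 0 := ((t.mem_heart_iff _).1 X₁.property).1
  have h₁' : t.IsGE X₁.obj 0 := ((t.mem_heart_iff _).1 X₁.property).2
  have h₂ : t.IsLE X₂.obj 0 := ((t.mem_heart_iff _).1 X₂.property).1
  have h₂' : t.IsGE X₂.obj 0 := ((t.mem_heart_iff _).1 X₂.property).2
  have h₄ : t.IsLE (X₁.obj⟦(1 : ℤ)⟧) (-1) := t.isLE_shift _ 0 1 (-1)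
  have h₄' : t.IsGE (X₁.obj⟦(1 : ℤ)⟧) (-1) := t.isGE_shift _ 0 1 (-1)
  have h₃ : t.IsLE X₃ 0 := t.isLE₂ _ (rot_of_distTriang _ hT) 0 h₂
    (t.isLE_of_le (X₁.obj⟦(1 : ℤ)⟧) (-1) 0)
  have h₃' : t.IsGE X₃ (-1) := t.isGE₂ _ (rot_of_distTriang _ hT) (-1)
    (t.isGE_of_ge X₂.obj (-1) 0) h₄'
  let A := (t.truncLE (-1)).obj X₃
  have hA : t.IsLE A (-1) := inferInstance
  have hA' : t.IsGE A (-1) := inferInstance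
  have hB : t.IsLE ((t.truncGE 0).obj X₃) 0 := inferInstance
  have hB' : t.IsGE ((t.truncGE 0).obj X₃) 0 := inferInstance
  have hK : t.heart (A⟦(-1 : ℤ)⟧) :=
    (t.mem_heart_iff _).2 ⟨t.isLE_shift _ (-1) (-1) 0, t.isGE_shift _ (-1) (-1) 0⟩
  let e : A⟦(-1 : ℤ)⟧⟦(1 : ℤ)⟧ ≅ A := (shiftEquiv D (1 : ℤ)).counitIso.app A
  refine ⟨⟨_, hK⟩, ⟨_, (t.mem_heart_iff _).2 ⟨hB, hB'⟩⟩,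
    e.hom ≫ (t.truncLEι (-1)).app X₃, (t.truncGEπ 0).app X₃,
    (t.truncGEδLE (-1) 0 rfl).app X₃ ≫ e.inv⟦(1 : ℤ)⟧',
    isomorphic_distinguished _ (t.triangleLEGE_distinguished (-1) 0 rfl X₃) _
      (Triangle.isoMk _ _ e (Iso.refl _) (Iso.refl _) ?_ ?_ ?_)⟩
  · exact Category.comp_id _
  · exact (Category.comp_id _).trans (Category.id_comp _).symm
  · change ((t.truncGEδLE (-1) 0 rfl).app X₃ ≫ e.inv⟦(1 : ℤ)⟧') ≫ e.hom⟦(1 : ℤ)⟧' =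
      𝟙 _ ≫ (t.truncGEδLE (-1) 0 rfl).app X₃
    rw [Category.assoc, ← Functor.map_comp, e.inv_hom_id, Functor.map_id]
    exact (Category.comp_id _).trans (Category.id_comp _).symm

instance heart_isClosedUnderBinaryProducts : t.heart.IsClosedUnderBinaryProducts where
  limitsOfShape_le := by
    rintro X ⟨p⟩
    have h₁ := (t.mem_heart_iff _).1 (p.prop_diag_obj (.mk .left))
    have h₂ := (t.mem_heart_iff _).1 (p.prop_diag_obj (.mk .right))
    refine t.heart.prop_of_iso ?_ ((t.mem_heart_iff _).2
      ⟨t.isLE₂ _ (binaryProductTriangle_distinguished _ _) 0 h₁.1 h₂.1,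
        t.isGE₂ _ (binaryProductTriangle_distinguished _ _) 0 h₁.2 h₂.2⟩)
    exact IsLimit.conePointUniqueUpToIso (prodIsProd _ _)
      ((IsLimit.postcomposeHomEquiv (diagramIsoPair p.diag) _).2 p.isLimit)

instance heart_containsZero : t.heart.ContainsZero where
  exists_zero := by
    obtain ⟨Z, hZ⟩ := HasZeroObject.zero (C := D)
    exact ⟨Z, hZ, (t.mem_heart_iff _).2 ⟨t.isLE_of_isZero hZ 0, t.isGE_of_isZero hZ 0⟩⟩

instance heart_isClosedUnderFiniteProducts : t.heart.IsClosedUnderFiniteProducts := .mk'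

noncomputable instance heartAbelian : Abelian t.heart.FullSubcategory :=
  AbelianSubcategory.abelian t.heart.ι t.heart_hom_negative_shift t.heart_admissibleMorphism

/-! Realization functors. -/

section Realization

variable [HasDerivedCategory.{w} t.heart.FullSubcategory]

/-- The canonical embedding of the heart `H` into the bounded derived category `D^b(H)`: an object
is sent to the corresponding stalk complex concentrated in degree `0`. -/
noncomputable def heartToBounded :
    t.heart.FullSubcategory ⥤ DerivedCategory.Bounded t.heart.FullSubcategory :=
  DerivedCategory.TStructure.t.bounded.lift
    (DerivedCategory.singleFunctor t.heart.FullSubcategory 0)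
    (fun _ ↦ ⟨⟨0, inferInstance⟩, ⟨0, inferInstance⟩⟩)

/-- A realization functor of a t-structure with heart `H`: a triangle functor `F : D^b(H) ⥤ D`
whose restriction to `H ⊆ D^b(H)` has (essential) image `H`, and is isomorphic to the
identity functor of `H`, i.e. to the inclusion when it is considered as a functor `H ⥤ D`. -/
structure IsRealizationFunctor
    (F : DerivedCategory.Bounded t.heart.FullSubcategory ⥤ D) [F.CommShift ℤ] : Prop where
  isTriangulated : F.IsTriangulated
  essImage_eq_heart : (t.heartToBounded ⋙ F).essImage = t.heart
  nonempty_iso : Nonempty (t.heartToBounded ⋙ F ≅ t.heart.ι)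

end Realization

end CategoryTheory.Triangulated.TStructure

/-! Both bounded categories are generated by their hearts under shifts and extensions
(`bounded_le_of_heart_le`). By the five lemma, full faithfulness therefore reduces to `Hom(X, Y[n])`
for `X`, `Y` in `H`. For `n < 0` both sides vanish, and for `n = 0` the restriction of `F` to `H` is
fully faithful. In degree 1, a class in `D` is the class of a triangle whose middle term lies in
`H`, hence of a short exact sequence that already has a class in `D^b(H)`
(`realization_map_surjective_one`). In degrees `n ≥ 2` surjectivity is free, since heredity kills
the target. Injectivity in degree `n + 1` follows from bijectivity in degree `n`: classes of
positive degree in `D^b(H)` are effaceable, so dimension shifting applies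
(`realization_map_bijective_nat`). Once `F` is full, its essential image is triangulated; it
contains the heart, hence all of `D`. -/

namespace CategoryTheory.Functor

section

variable {C : Type u} {D : Type u'} [Category.{v} C] [Category.{v'} D] (F : C ⥤ D)

lemma map_bijective_of_iso {X X' Y Y' : C} (e : X ≅ X') (e' : Y ≅ Y')
    (h : Function.Bijective (F.map (X := X) (Y := Y))) :
    Function.Bijective (F.map (X := X') (Y := Y')) := by
  constructor
  · intro f g hfg
    have : e.hom ≫ f ≫ e'.inv = e.hom ≫ g ≫ e'.inv := h.1 (by simp [hfg])
    simpa using this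
  · intro φ
    obtain ⟨f, hf⟩ := h.2 (F.map e.hom ≫ φ ≫ F.map e'.inv)
    refine ⟨e.inv ≫ f ≫ e'.hom, ?_⟩
    simp only [Functor.map_comp, hf, Category.assoc, ← F.map_comp_assoc, ← F.map_comp,
      Iso.inv_hom_id, Functor.map_id, Category.id_comp, Category.comp_id]

variable [HasShift C ℤ] [HasShift D ℤ] [F.CommShift ℤ]

lemma map_shift_bijective {X Y : C} (n : ℤ)
    (h : Function.Bijective (F.map (X := X) (Y := Y))) :
    Function.Bijective (F.map (X := X⟦n⟧) (Y := Y⟦n⟧)) := by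
  constructor
  · intro f g hfg
    obtain ⟨f, rfl⟩ := (shiftFunctor C n).map_surjective f
    obtain ⟨g, rfl⟩ := (shiftFunctor C n).map_surjective g
    congr 1
    apply h.1
    apply (shiftFunctor D n).map_injective
    have h₁ := F.commShiftIso_hom_naturality f n
    have h₂ := F.commShiftIso_hom_naturality g n
    rw [hfg, h₂] at h₁
    exact ((cancel_epi _).1 h₁).symm
  · intro φ
    obtain ⟨ψ, hψ⟩ := (shiftFunctor D n).map_surjective
      ((F.commShiftIso n).inv.app X ≫ φ ≫ (F.commShiftIso n).hom.app Y)
    obtain ⟨f, rfl⟩ := h.2 ψ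
    refine ⟨f⟦n⟧', ?_⟩
    rw [← cancel_mono ((F.commShiftIso n).hom.app Y), F.commShiftIso_hom_naturality, hψ]
    simp

end

section

variable {C : Type u} [Category.{v} C] [Preadditive C] [HasZeroObject C] [HasShift C ℤ]
  [∀ n : ℤ, (shiftFunctor C n).Additive] [Pretriangulated C]
  {X₁ X₂ X₃ : C} {f : X₁ ⟶ X₂} {g : X₂ ⟶ X₃} {h : X₃ ⟶ X₁⟦(1 : ℤ)⟧}

lemma exists_invRotate_distinguished (hT : Triangle.mk f g h ∈ distTriang C) :
    ∃ (w : X₃⟦(-1 : ℤ)⟧ ⟶ X₁) (k : X₂ ⟶ X₃⟦(-1 : ℤ)⟧⟦(1 : ℤ)⟧),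
      Triangle.mk w f k ∈ distTriang C :=
  ⟨_, _, inv_rot_of_distTriang _ hT⟩

lemma exists_rotate_distinguished (hT : Triangle.mk f g h ∈ distTriang C) :
    ∃ (k : X₁⟦(1 : ℤ)⟧ ⟶ X₂⟦(1 : ℤ)⟧), Triangle.mk g h k ∈ distTriang C :=
  ⟨_, rot_of_distTriang _ hT⟩

lemma comp_eq_zero_of_distinguished (hT : Triangle.mk f g h ∈ distTriang C) : f ≫ g = 0 :=
  comp_distTriang_mor_zero₁₂ _ hT

lemma exists_lift_of_distinguished (hT : Triangle.mk f g h ∈ distTriang C) {X : C}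
    (k : X ⟶ X₂) (hk : k ≫ g = 0) : ∃ (l : X ⟶ X₁), k = l ≫ f :=
  Triangle.coyoneda_exact₂ _ hT k hk

lemma exists_desc_of_distinguished (hT : Triangle.mk f g h ∈ distTriang C) {Y : C}
    (k : X₂ ⟶ Y) (hk : f ≫ k = 0) : ∃ (l : X₃ ⟶ Y), k = g ≫ l :=
  Triangle.yoneda_exact₂ _ hT k hk

end

/-! ### Five lemma arguments and dévissage for Hom sets -/

section

variable {C : Type u} {D : Type u'} [Category.{v} C] [Category.{v'} D]
  [Preadditive C] [Preadditive D] [HasZeroObject C] [HasZeroObject D]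
  [HasShift C ℤ] [HasShift D ℤ]
  [∀ n : ℤ, (shiftFunctor C n).Additive] [∀ n : ℤ, (shiftFunctor D n).Additive]
  [Pretriangulated C] [Pretriangulated D] (F : C ⥤ D) [F.CommShift ℤ] [F.IsTriangulated]
  {X₁ X₂ X₃ : C} {f : X₁ ⟶ X₂} {g : X₂ ⟶ X₃} {h : X₃ ⟶ X₁⟦(1 : ℤ)⟧}

lemma exists_map_distinguished (hT : Triangle.mk f g h ∈ distTriang C) :
    ∃ (k : F.obj X₃ ⟶ (F.obj X₁)⟦(1 : ℤ)⟧), Triangle.mk (F.map f) (F.map g) k ∈ distTriang D :=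
  ⟨_, F.map_distinguished _ hT⟩

/-- The dimension-shifting step: `k` comes from some `X ⟶ X₃⟦-1⟧`, whose image under `F` comes from
`X₂⟦-1⟧`; this lifts back to `C`, so `k` factors through two consecutive maps of a triangle. -/
lemma eq_zero_of_comp_eq_zero_of_map_eq_zero (hT : Triangle.mk f g h ∈ distTriang C) {X : C}
    (hs : Function.Surjective (F.map (X := X) (Y := X₂⟦(-1 : ℤ)⟧)))
    (hi : Function.Injective (F.map (X := X) (Y := X₃⟦(-1 : ℤ)⟧)))
    (k : X ⟶ X₁) (hk : k ≫ f = 0) (hk' : F.map k = 0) : k = 0 := by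
  obtain ⟨w, _, hT₁⟩ := exists_invRotate_distinguished hT
  obtain ⟨w', _, hT₂⟩ := exists_invRotate_distinguished hT₁
  obtain ⟨a, rfl⟩ := exists_lift_of_distinguished hT₁ k hk
  obtain ⟨_, hT₃⟩ := F.exists_map_distinguished hT₂
  obtain ⟨b, hb⟩ := exists_lift_of_distinguished hT₃ (F.map a) (by rw [← F.map_comp, hk'])
  obtain ⟨b, rfl⟩ := hs b
  obtain rfl : a = b ≫ w' := hi (by rw [hb, F.map_comp])
  rw [Category.assoc, comp_eq_zero_of_distinguished hT₂, comp_zero]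

lemma map_bijective_to_obj₂ (hT : Triangle.mk f g h ∈ distTriang C) {X : C}
    (h₁ : Function.Bijective (F.map (X := X) (Y := X₁)))
    (h₃ : Function.Bijective (F.map (X := X) (Y := X₃)))
    (h₁' : Function.Injective (F.map (X := X) (Y := X₁⟦(1 : ℤ)⟧)))
    (h₃' : Function.Surjective (F.map (X := X) (Y := X₃⟦(-1 : ℤ)⟧))) :
    Function.Bijective (F.map (X := X) (Y := X₂)) := by
  obtain ⟨_, hF⟩ := F.exists_map_distinguished hT
  constructor
  · refine (injective_iff_map_eq_zero (F.mapAddHom (X := X) (Y := X₂))).2 fun b hb ↦ ?_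
    replace hb : F.map b = 0 := hb
    obtain ⟨a, rfl⟩ := exists_lift_of_distinguished hT b
      (h₃.1 (by rw [F.map_comp, hb, zero_comp, F.map_zero]))
    obtain ⟨w, _, hT'⟩ := exists_invRotate_distinguished hT
    obtain ⟨_, hF'⟩ := F.exists_map_distinguished hT'
    obtain ⟨c, hc⟩ := exists_lift_of_distinguished hF' (F.map a) (by rw [← F.map_comp, hb])
    obtain ⟨c, rfl⟩ := h₃' c
    obtain rfl : a = c ≫ w := h₁.1 (by rw [F.map_comp, hc])
    rw [Category.assoc, comp_eq_zero_of_distinguished hT', comp_zero]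
  · intro φ
    obtain ⟨c, hc⟩ := h₃.2 (φ ≫ F.map g)
    obtain ⟨_, hT'⟩ := exists_rotate_distinguished hT
    obtain ⟨b, rfl⟩ := exists_lift_of_distinguished hT' c (h₁' (by
      rw [F.map_comp, hc, Category.assoc, ← F.map_comp, comp_eq_zero_of_distinguished hT',
        F.map_zero, comp_zero, F.map_zero]))
    obtain ⟨a, ha⟩ := exists_lift_of_distinguished hF (φ - F.map b) (by
      rw [Preadditive.sub_comp, ← hc, F.map_comp, sub_self])
    obtain ⟨a, rfl⟩ := h₁.2 a
    exact ⟨a ≫ f + b, by rw [F.map_add, F.map_comp, ← ha, sub_add_cancel]⟩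

lemma map_bijective_from_obj₂ (hT : Triangle.mk f g h ∈ distTriang C) {Y : C}
    (h₁ : Function.Bijective (F.map (X := X₁) (Y := Y)))
    (h₃ : Function.Bijective (F.map (X := X₃) (Y := Y)))
    (h₁' : Function.Surjective (F.map (X := X₁⟦(1 : ℤ)⟧) (Y := Y)))
    (h₃' : Function.Injective (F.map (X := X₃⟦(-1 : ℤ)⟧) (Y := Y))) :
    Function.Bijective (F.map (X := X₂) (Y := Y)) := by
  obtain ⟨_, hF⟩ := F.exists_map_distinguished hT
  constructor
  · refine (injective_iff_map_eq_zero (F.mapAddHom (X := X₂) (Y := Y))).2 fun b hb ↦ ?_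
    replace hb : F.map b = 0 := hb
    obtain ⟨c, rfl⟩ := exists_desc_of_distinguished hT b
      (h₁.1 (by rw [F.map_comp, hb, comp_zero, F.map_zero]))
    obtain ⟨_, hT'⟩ := exists_rotate_distinguished hT
    obtain ⟨_, hF'⟩ := F.exists_map_distinguished hT'
    obtain ⟨d, hd⟩ := exists_desc_of_distinguished hF' (F.map c) (by rw [← F.map_comp, hb])
    obtain ⟨d, rfl⟩ := h₁' d
    obtain rfl : c = h ≫ d := h₃.1 (by rw [F.map_comp, hd])
    rw [← Category.assoc, comp_eq_zero_of_distinguished hT', zero_comp]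
  · intro φ
    obtain ⟨a, ha⟩ := h₁.2 (F.map f ≫ φ)
    obtain ⟨w, _, hT'⟩ := exists_invRotate_distinguished hT
    obtain ⟨b, rfl⟩ := exists_desc_of_distinguished hT' a (h₃' (by
      rw [F.map_comp, ha, ← F.map_comp_assoc, comp_eq_zero_of_distinguished hT', F.map_zero,
        zero_comp, F.map_zero]))
    obtain ⟨c, hc⟩ := exists_desc_of_distinguished hF (φ - F.map b) (by
      rw [Preadditive.comp_sub, ← ha, F.map_comp, sub_self])
    obtain ⟨c, rfl⟩ := h₃.2 c
    exact ⟨g ≫ c + b, by rw [F.map_add, F.map_comp, ← hc, sub_add_cancel]⟩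

/-- The objects `Y` such that `F` is bijective on morphisms from `X` to all shifts of `Y`. -/
def bijectiveFrom (X : C) : ObjectProperty C :=
  fun Y ↦ ∀ (n : ℤ), Function.Bijective (F.map (X := X) (Y := Y⟦n⟧))

instance (X : C) : (F.bijectiveFrom X).IsTriangulated where
  exists_zero := ⟨_, isZero_zero _, fun n ↦ by
    have h₁ := (shiftFunctor C n).map_isZero (isZero_zero C)
    have h₂ := F.map_isZero h₁
    exact ⟨fun _ _ _ ↦ h₁.eq_of_tgt _ _, fun _ ↦ ⟨0, h₂.eq_of_tgt _ _⟩⟩⟩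
  isStableUnderShiftBy a := ⟨fun Y hY n ↦
    F.map_bijective_of_iso (Iso.refl _) ((shiftFunctorAdd C a n).app Y) (hY (a + n))⟩
  ext₂' T hT h₁ h₃ := ObjectProperty.le_isoClosure _ _ fun n ↦
    F.map_bijective_to_obj₂ (Triangle.shift_distinguished _ hT n) (h₁ n) (h₃ n)
      (F.map_bijective_of_iso (Iso.refl _) ((shiftFunctorAdd C n 1).app _) (h₁ (n + 1))).1
      (F.map_bijective_of_iso (Iso.refl _) ((shiftFunctorAdd C n (-1)).app _) (h₃ (n + (-1)))).2

instance (X : C) : (F.bijectiveFrom X).IsClosedUnderIsomorphisms where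
  of_iso e h n := F.map_bijective_of_iso (Iso.refl _) ((shiftFunctor C n).mapIso e) (h n)

/-- The objects `X` such that `F` is bijective on morphisms from `X` to any object. -/
def bijectiveFromAll : ObjectProperty C :=
  fun X ↦ ∀ (Y : C), Function.Bijective (F.map (X := X) (Y := Y))

/-- A shift of the source is traded for the opposite shift of the target, which is arbitrary. -/
instance : F.bijectiveFromAll.IsStableUnderShift ℤ where
  isStableUnderShiftBy a := ⟨fun _ hX Y ↦
    F.map_bijective_of_iso (Iso.refl _) ((shiftEquiv C a).counitIso.app Y)
      (F.map_shift_bijective a (hX (Y⟦-a⟧)))⟩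

instance : F.bijectiveFromAll.IsTriangulated where
  exists_zero := ⟨_, isZero_zero _, fun Y ↦ by
    have h₁ := isZero_zero C
    have h₂ := F.map_isZero h₁
    exact ⟨fun _ _ _ ↦ h₁.eq_of_src _ _, fun _ ↦ ⟨0, h₂.eq_of_src _ _⟩⟩⟩
  ext₂' T hT h₁ h₃ := ObjectProperty.le_isoClosure _ _ fun Y ↦
    F.map_bijective_from_obj₂ hT (h₁ Y) (h₃ Y)
      (F.bijectiveFromAll.le_shift (1 : ℤ) _ h₁ Y).2 (F.bijectiveFromAll.le_shift (-1) _ h₃ Y).1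

instance : F.bijectiveFromAll.IsClosedUnderIsomorphisms where
  of_iso e h Y := F.map_bijective_of_iso e (Iso.refl _) (h Y)

end

end CategoryTheory.Functor

namespace CategoryTheory.Triangulated.TStructure

/-- Induction on the amplitude, splitting off the top cohomology with a truncation triangle. -/
lemma bounded_le_of_heart_le {C : Type u} [Category.{v} C] [Preadditive C] [HasZeroObject C]
    [HasShift C ℤ] [∀ n : ℤ, (shiftFunctor C n).Additive] [Pretriangulated C] [IsTriangulated C]
    (t : TStructure C) (P : ObjectProperty C) [P.IsTriangulated] [P.IsClosedUnderIsomorphisms]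
    (h : t.heart ≤ P) : t.bounded ≤ P := by
  have key (a : ℤ) (X : C) (_ : t.IsGE X a) (_ : t.IsLE X a) : P X := by
    have h₁ : P (X⟦a⟧) := h _ ((t.mem_heart_iff _).2 ⟨t.isLE_shift X a a 0, t.isGE_shift X a a 0⟩)
    exact P.prop_of_iso ((shiftEquiv C a).unitIso.symm.app X) (P.le_shift (-a) _ h₁)
  have key' (n : ℕ) : ∀ (a : ℤ) (X : C) (_ : t.IsGE X a) (_ : t.IsLE X (a + n)), P X := by
    induction n with
    | zero => exact fun a X h₁ h₂ ↦ key a X h₁ (by simpa using h₂)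
    | succ n hn =>
      intro a X h₁ h₂
      refine P.ext_of_isTriangulatedClosed₂ _
        (t.triangleLEGE_distinguished (a + n) (a + n + 1) rfl X) ?_ ?_
      · exact hn a _ (inferInstanceAs (t.IsGE ((t.truncLE (a + n)).obj X) a))
          (inferInstanceAs (t.IsLE ((t.truncLE (a + n)).obj X) (a + n)))
      · have : t.IsLE X (a + n + 1) := by simpa [add_assoc] using h₂
        exact key (a + n + 1) _
          (inferInstanceAs (t.IsGE ((t.truncGE (a + n + 1)).obj X) (a + n + 1)))
          (inferInstanceAs (t.IsLE ((t.truncGE (a + n + 1)).obj X) (a + n + 1)))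
  rintro X ⟨⟨a, h₁⟩, ⟨b, h₂⟩⟩
  -- If `b < a`, `toNat` gives amplitude 0, which is still a valid bound.
  exact key' (b - a).toNat a X h₁ (t.isLE_of_le X b _ (by lia))

end CategoryTheory.Triangulated.TStructure

/-! ### Effaceability in the derived category -/

namespace DerivedCategory

variable {A : Type u} [Category.{v} A] [Abelian A] [HasDerivedCategory.{w} A]

/-- Write `f` as a fraction `g`, `s` through a complex `K` starting in degree `n`, and take `I = K.X
n`. The projection `p` of `K` onto its bottom term kills `g`, as `X` sits in degree `0 ≠ n`. The map
`i` is mono because `s` is a quasi-isomorphism. -/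
lemma exists_mono_comp_single_map_eq_zero {X Y : A} {n : ℤ} (hn : n < 0)
    (f : Q.obj ((HomologicalComplex.single A (.up ℤ) 0).obj X) ⟶
      Q.obj ((HomologicalComplex.single A (.up ℤ) n).obj Y)) :
    ∃ (I : A) (i : Y ⟶ I), Mono i ∧ f ≫ Q.map ((HomologicalComplex.single A (.up ℤ) n).map i) = 0 := by
  obtain ⟨K, _, g, s, hs, rfl⟩ := left_fac_of_isStrictlyGE f n
  let p : K ⟶ (HomologicalComplex.single A (.up ℤ) n).obj (K.X n) :=
    HomologicalComplex.mkHomToSingle (𝟙 (K.X n)) fun i hi ↦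
      (K.isZero_of_isStrictlyGE n i (by simp at hi; lia)).eq_of_src _ _
  let i : Y ⟶ K.X n := (HomologicalComplex.singleObjXSelf (.up ℤ) n Y).inv ≫ s.f n
  have hi : s ≫ p = (HomologicalComplex.single A (.up ℤ) n).map i := by
    apply HomologicalComplex.to_single_hom_ext
    simp [p, i, HomologicalComplex.single_map_f_self]
  have hg : g ≫ p = 0 := by
    apply HomologicalComplex.to_single_hom_ext
    exact (HomologicalComplex.isZero_single_obj_X (.up ℤ) 0 X n hn.ne).eq_of_src _ _
  refine ⟨K.X n, i, ?_, ?_⟩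
  · rw [Preadditive.mono_iff_cancel_zero]
    intro Z k hk
    have h₁ : (HomologicalComplex.single A (.up ℤ) n).map k ≫ s = 0 := by
      apply HomologicalComplex.from_single_hom_ext
      simpa [i, HomologicalComplex.single_map_f_self] using hk
    have h₂ : Q.map ((HomologicalComplex.single A (.up ℤ) n).map k) = 0 := by
      rw [← cancel_mono (Q.map s), ← Q.map_comp, h₁, Q.map_zero, zero_comp]
    apply (singleFunctor A n).map_injective
    rw [← cancel_mono ((singleFunctorIsoCompQ A n).hom.app _), Functor.map_zero, zero_comp]
    exact ((singleFunctorIsoCompQ A n).hom.naturality k).trans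
      ((congrArg _ h₂).trans comp_zero)
  · rw [← hi, Q.map_comp, Category.assoc, IsIso.inv_hom_id_assoc, ← Q.map_comp, hg, Q.map_zero]

/-- Morphisms from a stalk complex to a positive shift of a stalk complex are effaceable. -/
lemma exists_mono_comp_singleFunctor_map_shift_eq_zero {X Y : A} {n : ℤ} (hn : 0 < n)
    (f : (singleFunctor A 0).obj X ⟶ ((singleFunctor A 0).obj Y)⟦n⟧) :
    ∃ (I : A) (i : Y ⟶ I), Mono i ∧ f ≫ ((singleFunctor A 0).map i)⟦n⟧' = 0 := by
  let e : singleFunctor A 0 ⋙ shiftFunctor (DerivedCategory A) n ≅ singleFunctor A (-n) :=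
    (singleFunctors A).shiftIso n (-n) 0 (by lia)
  let e' : singleFunctor A 0 ⋙ shiftFunctor (DerivedCategory A) n ≅
      CochainComplex.singleFunctor A (-n) ⋙ Q := e ≪≫ singleFunctorIsoCompQ A (-n)
  obtain ⟨I, i, hi, h⟩ := exists_mono_comp_single_map_eq_zero (n := -n) (by lia)
    ((singleFunctorIsoCompQ A 0).inv.app X ≫ f ≫ e'.hom.app Y)
  refine ⟨I, i, hi, ?_⟩
  have h₁ : ((singleFunctor A 0).map i)⟦n⟧' ≫ e'.hom.app I =
      e'.hom.app Y ≫ (CochainComplex.singleFunctor A (-n) ⋙ Q).map i := e'.hom.naturality i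
  have h₂ : ((singleFunctorIsoCompQ A 0).inv.app X ≫ f ≫ e'.hom.app Y) ≫
      (CochainComplex.singleFunctor A (-n) ⋙ Q).map i = 0 := h
  rw [← cancel_mono (e'.hom.app I), ← cancel_epi ((singleFunctorIsoCompQ A 0).inv.app X),
    Category.assoc, h₁, zero_comp, comp_zero, ← h₂, Category.assoc, Category.assoc]

end DerivedCategory

/-! ### The heart inside `D` and inside `D^b(H)` -/

namespace CategoryTheory.Triangulated.TStructure

variable {D : Type u} [Category.{v} D] [Preadditive D] [HasZeroObject D] [HasShift D ℤ]
  [∀ n : ℤ, (shiftFunctor D n).Additive] [Pretriangulated D] [IsTriangulated D]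
  (t : TStructure D)

lemma shortExact_of_heart_distinguished {X₁ X₂ X₃ : t.heart.FullSubcategory}
    (f : X₁ ⟶ X₂) (g : X₂ ⟶ X₃) (h : X₃.obj ⟶ X₁.obj⟦(1 : ℤ)⟧)
    (hT : Triangle.mk (t.heart.ι.map f) (t.heart.ι.map g) h ∈ distTriang D) :
    ∃ (w : f ≫ g = 0), (ShortComplex.mk f g w).ShortExact := by
  have w : f ≫ g = 0 := t.heart.ι.map_injective (by
    rw [Functor.map_comp, Functor.map_zero]
    exact Functor.comp_eq_zero_of_distinguished hT)
  have h₁ := AbelianSubcategory.isLimitKernelForkOfDistTriang (ι := t.heart.ι)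
    t.heart_hom_negative_shift f g h hT
  have h₂ := AbelianSubcategory.isColimitCokernelCoforkOfDistTriang (ι := t.heart.ι)
    t.heart_hom_negative_shift f g h hT
  exact ⟨w, { exact := ShortComplex.exact_of_f_is_kernel _ h₁
              mono_f := mono_of_isLimit_fork h₁
              epi_g := epi_of_isColimit_cofork h₂ }⟩

variable [HasDerivedCategory.{w} t.heart.FullSubcategory]

lemma heartToBounded_exists_distinguished {S : ShortComplex t.heart.FullSubcategory}
    (hS : S.ShortExact) :
    ∃ (δ : t.heartToBounded.obj S.X₃ ⟶ (t.heartToBounded.obj S.X₁)⟦(1 : ℤ)⟧),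
      Triangle.mk (t.heartToBounded.map S.f) (t.heartToBounded.map S.g) δ ∈ distTriang _ := by
  let ι := DerivedCategory.Bounded.ι (C := t.heart.FullSubcategory)
  let δ' : ι.obj (t.heartToBounded.obj S.X₃) ⟶ (ι.obj (t.heartToBounded.obj S.X₁))⟦(1 : ℤ)⟧ :=
    hS.singleδ
  refine ⟨ι.preimage (δ' ≫ (ι.commShiftIso (1 : ℤ)).inv.app _),
    (ι.map_distinguished_iff _).1 (isomorphic_distinguished _ hS.singleTriangle_distinguished _
      (Triangle.isoMk _ _ (Iso.refl _) (Iso.refl _) (Iso.refl _) ?_ ?_ ?_))⟩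
  · exact (Category.comp_id _).trans (Category.id_comp _).symm
  · exact (Category.comp_id _).trans (Category.id_comp _).symm
  · have h₁ : ι.map (ι.preimage (δ' ≫ (ι.commShiftIso (1 : ℤ)).inv.app _)) ≫
        (ι.commShiftIso (1 : ℤ)).hom.app _ = δ' := by
      rw [ι.map_preimage, Category.assoc, Iso.inv_hom_id_app]
      exact Category.comp_id _
    refine ((congrArg (fun k ↦ _ ≫ k) (Functor.map_id _ _)).trans (Category.comp_id _)).trans ?_
    exact h₁.trans (Category.id_comp _).symm

lemma heartToBounded_effaceable {X Y : t.heart.FullSubcategory} {n : ℤ} (hn : 0 < n)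
    (f : t.heartToBounded.obj X ⟶ (t.heartToBounded.obj Y)⟦n⟧) :
    ∃ (I : t.heart.FullSubcategory) (i : Y ⟶ I),
      Mono i ∧ f ≫ (t.heartToBounded.map i)⟦n⟧' = 0 := by
  let ι := DerivedCategory.Bounded.ι (C := t.heart.FullSubcategory)
  obtain ⟨I, i, hi, h⟩ := DerivedCategory.exists_mono_comp_singleFunctor_map_shift_eq_zero hn
    (ι.map f ≫ (ι.commShiftIso n).hom.app _)
  refine ⟨I, i, hi, ι.map_injective ?_⟩
  rw [← cancel_mono ((ι.commShiftIso n).hom.app _), Functor.map_comp, Category.assoc,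
    ι.commShiftIso_hom_naturality, Functor.map_zero, zero_comp, ← Category.assoc]
  exact h

lemma heartToBounded_hom_negative_shift {X Y : t.heart.FullSubcategory} {n : ℤ} (hn : n < 0)
    (f : t.heartToBounded.obj X ⟶ (t.heartToBounded.obj Y)⟦n⟧) : f = 0 := by
  let ι := DerivedCategory.Bounded.ι (C := t.heart.FullSubcategory)
  let t' := DerivedCategory.TStructure.t (C := t.heart.FullSubcategory)
  have : t'.IsLE (ι.obj (t.heartToBounded.obj X)) 0 :=
    inferInstanceAs (((DerivedCategory.singleFunctor _ 0).obj X).IsLE 0)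
  have : t'.IsGE (ι.obj (t.heartToBounded.obj Y)) 0 :=
    inferInstanceAs (((DerivedCategory.singleFunctor _ 0).obj Y).IsGE 0)
  have : t'.IsGE ((ι.obj (t.heartToBounded.obj Y))⟦n⟧) (-n) := t'.isGE_shift _ 0 n (-n)
  apply ι.map_injective
  rw [← cancel_mono ((ι.commShiftIso n).hom.app _), Functor.map_zero, zero_comp]
  exact t'.zero_of_isLE_of_isGE _ 0 (-n) (by lia) inferInstance this

lemma heart_onBounded_le_essImage :
    (DerivedCategory.TStructure.t (C := t.heart.FullSubcategory)).onBounded.heart ≤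
      t.heartToBounded.essImage := by
  intro X hX
  have hX' := (mem_heart_iff _ _).1 hX
  simp only [ObjectProperty.tStructure_isLE_iff, ObjectProperty.tStructure_isGE_iff] at hX'
  have h₁ : X.obj.IsLE 0 := hX'.1
  have h₂ : X.obj.IsGE 0 := hX'.2
  obtain ⟨Y, ⟨e⟩⟩ := DerivedCategory.exists_iso_singleFunctor_obj_of_isGE_of_isLE X.obj 0
  exact ⟨Y, ⟨(DerivedCategory.Bounded.ι.preimageIso (X := X) (Y := t.heartToBounded.obj Y) e).symm⟩⟩

instance : t.heartToBounded.Faithful :=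
  have : (t.heartToBounded ⋙ DerivedCategory.Bounded.ι).Faithful :=
    inferInstanceAs (DerivedCategory.singleFunctor t.heart.FullSubcategory 0).Faithful
  .of_comp t.heartToBounded DerivedCategory.Bounded.ι

instance : t.heartToBounded.Full :=
  have : (t.heartToBounded ⋙ DerivedCategory.Bounded.ι).Full :=
    inferInstanceAs (DerivedCategory.singleFunctor t.heart.FullSubcategory 0).Full
  .of_comp_faithful t.heartToBounded DerivedCategory.Bounded.ι

lemma bounded_onBounded {A : Type u} [Category.{v} A] [Abelian A] [HasDerivedCategory.{w} A]
    (X : DerivedCategory.Bounded A) :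
    (DerivedCategory.TStructure.t (C := A)).onBounded.bounded X := by
  obtain ⟨⟨a, h₁⟩, ⟨b, h₂⟩⟩ := X.property
  exact ⟨⟨a, (ObjectProperty.tStructure_isGE_iff _ _ _ _).2 h₁⟩,
    ⟨b, (ObjectProperty.tStructure_isLE_iff _ _ _ _).2 h₂⟩⟩

/-! ### A realization functor on the heart, degree by degree -/

section

variable {t} {F : DerivedCategory.Bounded t.heart.FullSubcategory ⥤ D}

lemma realization_map_bijective_zero (e : t.heartToBounded ⋙ F ≅ t.heart.ι)
    (X Y : t.heart.FullSubcategory) :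
    Function.Bijective (F.map (X := t.heartToBounded.obj X) (Y := t.heartToBounded.obj Y)) := by
  have := Functor.Full.of_iso e.symm
  have := Functor.Faithful.of_iso e.symm
  constructor
  · intro f g hfg
    obtain ⟨f, rfl⟩ := t.heartToBounded.map_surjective f
    obtain ⟨g, rfl⟩ := t.heartToBounded.map_surjective g
    rw [(t.heartToBounded ⋙ F).map_injective hfg]
  · intro φ
    obtain ⟨f, hf⟩ := (t.heartToBounded ⋙ F).map_surjective φ
    exact ⟨t.heartToBounded.map f, hf⟩

variable [F.CommShift ℤ] [F.IsTriangulated]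

lemma realization_map_surjective_one (e : t.heartToBounded ⋙ F ≅ t.heart.ι)
    (X Y : t.heart.FullSubcategory) :
    Function.Surjective (F.map (X := t.heartToBounded.obj X)
      (Y := (t.heartToBounded.obj Y)⟦(1 : ℤ)⟧)) := by
  intro φ
  let eX : F.obj (t.heartToBounded.obj X) ≅ X.obj := e.app X
  let eY : F.obj (t.heartToBounded.obj Y) ≅ Y.obj := e.app Y
  let ψ : X.obj ⟶ Y.obj⟦(1 : ℤ)⟧ :=
    eX.inv ≫ φ ≫ (F.commShiftIso (1 : ℤ)).hom.app _ ≫ eY.hom⟦(1 : ℤ)⟧'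
  obtain ⟨E, i, p, hT⟩ := distinguished_cocone_triangle₂ ψ
  have hX := (t.mem_heart_iff _).1 X.property
  have hY := (t.mem_heart_iff _).1 Y.property
  have hE : t.heart E :=
    -- The heart is closed under extensions.
    (t.mem_heart_iff _).2 ⟨t.isLE₂ _ hT 0 hY.1 hX.1, t.isGE₂ _ hT 0 hY.2 hX.2⟩
  let E' : t.heart.FullSubcategory := ⟨E, hE⟩
  obtain ⟨i, rfl⟩ : ∃ i' : Y ⟶ E', t.heart.ι.map i' = i :=
    t.heart.ι.map_surjective (X := Y) (Y := E') i
  obtain ⟨p, rfl⟩ : ∃ p' : E' ⟶ X, t.heart.ι.map p' = p :=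
    t.heart.ι.map_surjective (X := E') (Y := X) p
  obtain ⟨w, hS⟩ := t.shortExact_of_heart_distinguished i p ψ hT
  have : Epi p := hS.epi_g
  obtain ⟨δ, hδ⟩ : ∃ (δ : t.heartToBounded.obj X ⟶ (t.heartToBounded.obj Y)⟦(1 : ℤ)⟧),
      Triangle.mk (t.heartToBounded.map i) (t.heartToBounded.map p) δ ∈ distTriang _ :=
    t.heartToBounded_exists_distinguished hS
  obtain ⟨c, hc₁, hc₂⟩ : ∃ (c : F.obj (t.heartToBounded.obj X) ⟶ X.obj),
      F.map (t.heartToBounded.map p) ≫ c = e.hom.app E' ≫ t.heart.ι.map p ∧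
      (F.map δ ≫ (F.commShiftIso (1 : ℤ)).hom.app _) ≫ eY.hom⟦(1 : ℤ)⟧' = c ≫ ψ :=
    complete_distinguished_triangle_morphism _ _
      (F.map_distinguished _ hδ) hT eY.hom (e.hom.app E') (e.hom.naturality i)
  -- The third map of a morphism of triangles is not unique in general; here it is forced, since `p`
  -- is epi in the heart.
  have hc : c = eX.hom := by
    obtain ⟨c', hc'⟩ : ∃ c' : X ⟶ X, t.heart.ι.map c' = eX.inv ≫ c :=
      t.heart.ι.map_surjective (X := X) (Y := X) _
    have h₁ : F.map (t.heartToBounded.map p) ≫ eX.hom = e.hom.app E' ≫ t.heart.ι.map p :=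
      e.hom.naturality p
    have h₂ : (e.hom.app E' ≫ t.heart.ι.map p) ≫ eX.inv ≫ c = e.hom.app E' ≫ t.heart.ι.map p := by
      rw [← h₁, Category.assoc, Iso.hom_inv_id_assoc, hc₁, h₁]
    have h₃ : p ≫ c' = p ≫ 𝟙 X := t.heart.ι.map_injective (by
      rw [Functor.map_comp, hc', ← cancel_epi (e.hom.app E'), Category.comp_id]
      exact (Category.assoc _ _ _).symm.trans h₂)
    rw [cancel_epi] at h₃
    rw [← cancel_epi eX.inv, ← hc', h₃, eX.inv_hom_id]
    rfl
  refine ⟨δ, ?_⟩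
  rw [hc, Iso.hom_inv_id_assoc, ← Category.assoc, cancel_mono, cancel_mono] at hc₂
  exact hc₂

lemma realization_map_bijective_nat (ht : t.IsHereditary) (e : t.heartToBounded ⋙ F ≅ t.heart.ι)
    (n : ℕ) : ∀ (X Y : t.heart.FullSubcategory),
    Function.Bijective (F.map (X := t.heartToBounded.obj X)
      (Y := (t.heartToBounded.obj Y)⟦(n : ℤ)⟧)) := by
  induction n with
  | zero =>
    exact fun X Y ↦ F.map_bijective_of_iso (Iso.refl _)
      ((shiftFunctorZero _ ℤ).symm.app (t.heartToBounded.obj Y))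
      (realization_map_bijective_zero e X Y)
  | succ n hn =>
    intro X Y
    constructor
    · refine (injective_iff_map_eq_zero (F.mapAddHom (X := t.heartToBounded.obj X)
        (Y := (t.heartToBounded.obj Y)⟦((n + 1 : ℕ) : ℤ)⟧))).2 fun f hf ↦ ?_
      obtain ⟨I, i, hi, h⟩ := t.heartToBounded_effaceable (by lia) f
      have hS : (ShortComplex.mk _ _ (cokernel.condition i)).ShortExact :=
        { exact := ShortComplex.exact_cokernel i }
      obtain ⟨δ, hδ⟩ := t.heartToBounded_exists_distinguished hS
      -- The induction hypothesis in degree `n`, rewritten for `⟦n + 1⟧⟦-1⟧`.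
      have hn' (Z : t.heart.FullSubcategory) :=
        F.map_bijective_of_iso (Iso.refl (t.heartToBounded.obj X))
          ((shiftFunctorAdd' _ ((n + 1 : ℕ) : ℤ) (-1) (n : ℤ) (by lia)).app
            (t.heartToBounded.obj Z)) (hn X Z)
      have hδ' := Triangle.shift_distinguished _ hδ ((n + 1 : ℕ) : ℤ)
      refine F.eq_zero_of_comp_eq_zero_of_map_eq_zero hδ' (hn' _).2 (hn' _).1 f ?_ hf
      -- Shifting the triangle introduced a sign in its first map, harmless here.
      exact (Preadditive.comp_zsmul ..).trans ((congrArg _ h).trans (zsmul_zero _))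
    · match n with
      | 0 => exact realization_map_surjective_one e X Y
      | m + 1 =>
        intro φ
        refine ⟨0, ?_⟩
        rw [F.map_zero, ← cancel_mono ((F.commShiftIso ((m + 1 + 1 : ℕ) : ℤ)).hom.app _),
          zero_comp]
        have hX := t.heart.prop_of_iso (e.symm.app X) X.property
        have hY := t.heart.prop_of_iso (e.symm.app Y) Y.property
        exact (ht.hom_shift_eq_zero _ _ hX hY ((m + 1 + 1 : ℕ) : ℤ) (by lia) _).symm

lemma realization_map_bijective (ht : t.IsHereditary) (e : t.heartToBounded ⋙ F ≅ t.heart.ι)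
    (X Y : t.heart.FullSubcategory) (n : ℤ) :
    Function.Bijective (F.map (X := t.heartToBounded.obj X)
      (Y := (t.heartToBounded.obj Y)⟦n⟧)) := by
  by_cases hn : 0 ≤ n
  · obtain ⟨n, rfl⟩ := Int.eq_ofNat_of_zero_le hn
    exact realization_map_bijective_nat ht e n X Y
  · have hn' : n < 0 := by lia
    refine ⟨fun f g _ ↦ ?_, fun φ ↦ ⟨0, ?_⟩⟩
    · rw [t.heartToBounded_hom_negative_shift hn' f, t.heartToBounded_hom_negative_shift hn' g]
    · rw [F.map_zero, ← cancel_mono ((F.commShiftIso n).hom.app _), zero_comp]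
      exact (t.heart_hom_negative_shift
        (X := ⟨_, t.heart.prop_of_iso (e.symm.app X) X.property⟩)
        (Y := ⟨_, t.heart.prop_of_iso (e.symm.app Y) Y.property⟩) _ hn').symm

lemma realization_map_bijective_all (ht : t.IsHereditary)
    (e : t.heartToBounded ⋙ F ≅ t.heart.ι)
    (X Y : DerivedCategory.Bounded t.heart.FullSubcategory) :
    Function.Bijective (F.map (X := X) (Y := Y)) := by
  -- Dévissage first in the source, then, for a source in the heart, in the target.
  refine bounded_le_of_heart_le _ F.bijectiveFromAll (fun X hX ↦ ?_) X (bounded_onBounded X) Y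
  obtain ⟨A, ⟨eA⟩⟩ := t.heart_onBounded_le_essImage X hX
  refine F.bijectiveFromAll.prop_of_iso eA fun Y ↦ ?_
  refine F.map_bijective_of_iso (Iso.refl _) ((shiftFunctorZero _ ℤ).app Y) ?_
  refine bounded_le_of_heart_le _ (F.bijectiveFrom _) (fun Y hY ↦ ?_) Y (bounded_onBounded Y) 0
  obtain ⟨B, ⟨eB⟩⟩ := t.heart_onBounded_le_essImage Y hY
  exact (F.bijectiveFrom _).prop_of_iso eB (realization_map_bijective ht e A B)

end

end CategoryTheory.Triangulated.TStructure

theorem lemma3p1 {D : Type u} [Category.{v} D] [Preadditive D] [HasZeroObject D] [HasShift D ℤ]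
    [∀ n : ℤ, (shiftFunctor D n).Additive] [Pretriangulated D] [IsTriangulated D]
    (t : TStructure D) (ht : t.IsHereditary)
    [HasDerivedCategory.{w} t.heart.FullSubcategory]
    (F : DerivedCategory.Bounded t.heart.FullSubcategory ⥤ D) [F.CommShift ℤ]
    (hF : t.IsRealizationFunctor F) :
    F.IsTriangleEquivalence := by
  have := hF.isTriangulated
  obtain ⟨e⟩ := hF.nonempty_iso
  have bij := TStructure.realization_map_bijective_all ht e
  have : F.Full := ⟨fun {X Y} ↦ (bij X Y).2⟩
  have : F.Faithful := ⟨fun {X Y} ↦ (bij X Y).1⟩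
  have : F.EssSurj := ⟨fun X ↦ t.bounded_le_of_heart_le F.essImage
    (fun Y hY ↦ ⟨t.heartToBounded.obj ⟨Y, hY⟩, ⟨e.app ⟨Y, hY⟩⟩⟩) X (ht.bounded X)⟩
  have hF' : F.IsEquivalence := {}
  let adj : F ⊣ F.inv := F.asEquivalence.toAdjunction
  -- The shift structure on the inverse is the one induced by the adjunction, so compatibility of
  -- unit and counit is automatic.
  let : F.inv.CommShift ℤ := adj.rightAdjointCommShift ℤ
  have : adj.CommShift ℤ := adj.commShift_of_leftAdjoint ℤ
  exact ⟨hF', F.inv, inferInstance, adj, .mk' adj⟩
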